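/- Let $F$ be Thompson's group, i.e. the group of all orientation preserving piecewise linear homeomorphisms of $[0,1]$ that are differentiable except at finitely many dyadic rationals and whose slopes are (integer) powers of $2$. Every $f\in F$ is represented by a unique reduced tree diagram $(T_+,T_-)$, a pair of planar binary rooted trees with the same number $n$ of leaves, minimal among all such pairs with the property that $f$ maps the standard dyadic interval of the $i$-th leaf of $T_+$ affinely and increasingly onto that of the $i$-th leaf of $T_-$, for every $i$. Draw $T_+$ in the strip $\{-1\le y\le 1\}$ above the $x$-axis, with its leaves at consecutive integers of the axis, and draw $T_-$ upside down below the axis with the same leaves, joining the root of $T_+$ by an edge to the line $y=1$ and the root of $T_-$ by an edge to the line $y=-1$. This partitions the strip into $n+1$ regions. Call $f$ $3$-colorable if the regions can be colored with three colors so that any two regions sharing an edge have different colors. **Theorem.** The set $\mathcal F$ of all $3$-colorable elements of $F$ is a subgroup of $F$ (the $3$-colorable subgroup), and it coincides with its commensurator in $F$: $$\{g\in F : \mathcal F\cap g\mathcal Fg^{-1}\text{ has finite index in both }\mathcal F\text{ and } g\mathcal Fg^{-1}\}=\mathcal F .$$ -/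

import Mathlib

/-! ### Thompson's group `F` -/

/-- Dyadic rational numbers, i.e. the elements of `ℤ[1/2]`. -/
def IsDyadic (x : ℝ) : Prop := ∃ (m : ℤ) (n : ℕ), x = m / 2 ^ n

/-- An (orientation preserving) homeomorphism of `[0,1]` belongs to Thompson's group if there is
a finite set of dyadic rationals such that, on every interval whose interior avoids this set, the
homeomorphism is affine with slope a power of `2` (with integer exponent). -/
def IsThompson (f : unitInterval ≃ₜ unitInterval) : Prop :=
  StrictMono f ∧ ∃ S : Finset unitInterval, (∀ s ∈ S, IsDyadic s) ∧
    ∀ a b : unitInterval, a < b → (∀ s ∈ S, s ∉ Set.Ioo a b) →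
      ∃ (k : ℤ) (c : ℝ), ∀ x ∈ Set.Icc a b, (f x : ℝ) = 2 ^ k * (x : ℝ) + c

theorem IsDyadic.add {x y : ℝ} (hx : IsDyadic x) (hy : IsDyadic y) : IsDyadic (x + y) := by
  obtain ⟨m, n, rfl⟩ := hx
  obtain ⟨m', n', rfl⟩ := hy
  refine ⟨m * 2 ^ n' + m' * 2 ^ n, n + n', ?_⟩
  push_cast
  field_simp
  ring

theorem IsDyadic.neg {x : ℝ} (hx : IsDyadic x) : IsDyadic (-x) := by
  obtain ⟨m, n, rfl⟩ := hx
  exact ⟨-m, n, by push_cast; ring⟩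

theorem IsDyadic.zpow_mul {x : ℝ} (hx : IsDyadic x) (k : ℤ) : IsDyadic ((2 : ℝ) ^ k * x) := by
  obtain ⟨m, n, rfl⟩ := hx
  obtain ⟨j, rfl | rfl⟩ := k.eq_nat_or_neg
  · exact ⟨2 ^ j * m, n, by push_cast; rw [zpow_natCast]; ring⟩
  · refine ⟨m, j + n, ?_⟩
    rw [zpow_neg, zpow_natCast, pow_add]
    field_simp

theorem IsThompson.map_zero {f : unitInterval ≃ₜ unitInterval} (hf : IsThompson f) : f 0 = 0 := by
  obtain ⟨x, hx⟩ := f.surjective 0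
  have h : f 0 ≤ f x := hf.1.monotone unitInterval.nonneg'
  rw [hx] at h
  exact le_antisymm h unitInterval.nonneg'

/-- Elements of Thompson's group preserve the set of dyadic rationals in `[0,1]`. -/
theorem IsThompson.isDyadic_iff {f : unitInterval ≃ₜ unitInterval} (hf : IsThompson f)
    (x : unitInterval) : IsDyadic (f x) ↔ IsDyadic x := by
  have h0 : IsDyadic ((0 : unitInterval) : ℝ) := ⟨0, 0, by simp⟩
  have hf0 := hf.map_zero
  obtain ⟨-, S, hS, hA⟩ := hf
  suffices H : ∀ (n : ℕ) (x : unitInterval), ((insert 0 S).filter (· < x)).card = n →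
      (IsDyadic (f x) ↔ IsDyadic x) from H _ x rfl
  intro n
  induction n using Nat.strong_induction_on with
  | _ n ih =>
    intro x hx
    by_cases hx0 : x = 0
    · subst hx0
      rw [hf0]
    have hpos : 0 < x := unitInterval.pos_iff_ne_zero.2 hx0
    have hne : ((insert 0 S).filter (· < x)).Nonempty := ⟨0, by simp [hpos]⟩
    set a := ((insert 0 S).filter (· < x)).max' hne with ha
    have hmem := Finset.max'_mem _ hne
    rw [← ha, Finset.mem_filter] at hmem
    have haD : IsDyadic a := by
      rcases Finset.mem_insert.1 hmem.1 with h | h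
      · rw [h]; exact h0
      · exact hS _ h
    have hlt : ((insert 0 S).filter (· < a)).card < n := by
      rw [← hx]
      apply Finset.card_lt_card
      refine ⟨fun s hs => ?_, fun hsub => ?_⟩
      · rw [Finset.mem_filter] at hs ⊢
        exact ⟨hs.1, hs.2.trans hmem.2⟩
      · have := hsub (Finset.mem_filter.2 hmem)
        simp at this
    have hfa : IsDyadic (f a) := (ih _ hlt a rfl).2 haD
    obtain ⟨k, c, hk⟩ := hA a x hmem.2 (by
      intro s hs hsI
      have : s ≤ a := Finset.le_max' _ _ (Finset.mem_filter.2
        ⟨Finset.mem_insert_of_mem hs, hsI.2⟩)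
      exact absurd hsI.1 (not_lt.2 this))
    have e1 := hk a ⟨le_rfl, hmem.2.le⟩
    have e2 := hk x ⟨hmem.2.le, le_rfl⟩
    constructor
    · intro h
      have e : (x : ℝ) = a + 2 ^ (-k) * ((f x : ℝ) + -(f a : ℝ)) := by
        rw [e1, e2, zpow_neg]
        field_simp
        ring
      rw [e]
      exact haD.add ((h.add hfa.neg).zpow_mul _)
    · intro h
      have e : (f x : ℝ) = f a + 2 ^ k * ((x : ℝ) + -(a : ℝ)) := by
        rw [e1, e2]
        ring
      rw [e]
      exact hfa.add ((h.add haD.neg).zpow_mul _)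

/-- Thompson's group `F`, as a subgroup of the group of homeomorphisms of `[0,1]`. -/
def thompsonF : Subgroup (unitInterval ≃ₜ unitInterval) where
  carrier := {f | IsThompson f}
  one_mem' := ⟨strictMono_id, ∅, by simp, fun a b _ _ => ⟨0, 0, fun x _ => by simp⟩⟩
  mul_mem' := by
    classical
    intro g f hg hf
    have hfd := fun y => IsThompson.isDyadic_iff hf (f.symm y)
    obtain ⟨mf, S, hS, hA⟩ := hf
    obtain ⟨mg, T, hT, hB⟩ := hg
    refine ⟨mg.comp mf, S ∪ T.image f.symm, ?_, ?_⟩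
    · intro s hs
      rcases Finset.mem_union.1 hs with h | h
      · exact hS s h
      · obtain ⟨t, ht, rfl⟩ := Finset.mem_image.1 h
        rw [← hfd, f.apply_symm_apply]
        exact hT t ht
    · intro a b hab h
      obtain ⟨k, c, hk⟩ := hA a b hab fun s hs => h s (Finset.mem_union_left _ hs)
      obtain ⟨l, d, hl⟩ := hB (f a) (f b) (mf hab) (by
        intro t ht htI
        refine h _ (Finset.mem_union_right _ (Finset.mem_image_of_mem _ ht)) ⟨?_, ?_⟩
        · rw [← mf.lt_iff_lt, f.apply_symm_apply]; exact htI.1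
        · rw [← mf.lt_iff_lt, f.apply_symm_apply]; exact htI.2)
      refine ⟨l + k, 2 ^ l * c + d, fun x hx => ?_⟩
      have e := hl (f x) ⟨mf.monotone hx.1, mf.monotone hx.2⟩
      rw [hk x hx] at e
      rw [zpow_add₀ (by norm_num)]
      rw [show ((g * f) x : ℝ) = g (f x) from rfl, e]
      ring
  inv_mem' := by
    classical
    intro f hf
    have hfd := fun y => IsThompson.isDyadic_iff hf y
    obtain ⟨mf, S, hS, hA⟩ := hf
    have mi : StrictMono f.symm := fun x y hxy => by
      rw [← mf.lt_iff_lt, f.apply_symm_apply, f.apply_symm_apply]; exact hxy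
    refine ⟨mi, S.image f, ?_, ?_⟩
    · intro s hs
      obtain ⟨t, ht, rfl⟩ := Finset.mem_image.1 hs
      exact (hfd t).2 (hS t ht)
    · intro a b hab h
      obtain ⟨k, c, hk⟩ := hA (f.symm a) (f.symm b) (mi hab) (by
        intro t ht htI
        refine h _ (Finset.mem_image_of_mem _ ht) ⟨?_, ?_⟩
        · rw [← mi.lt_iff_lt, f.symm_apply_apply]; exact htI.1
        · rw [← mi.lt_iff_lt, f.symm_apply_apply]; exact htI.2)
      refine ⟨-k, -(2 ^ (-k) * c), fun x hx => ?_⟩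
      have e := hk (f.symm x) ⟨mi.monotone hx.1, mi.monotone hx.2⟩
      rw [f.apply_symm_apply] at e
      rw [show ((f⁻¹ x : unitInterval) : ℝ) = f.symm x from rfl, e, zpow_neg]
      field_simp
      ring

/-! ### Tree diagrams

A planar binary rooted tree is a `BinaryTree Unit`: `nil` is a leaf and `node () l r` is a vertex
with left subtree `l` and right subtree `r`. -/

/-- The leaves of a tree from left to right, each given by the path from the root to it
(`false` for a left edge, `true` for a right edge). -/
def leafWords : BinaryTree Unit → List (List Bool)
  | .nil => [[]]
  | .node _ l r => (leafWords l).map (List.cons false) ++ (leafWords r).map (List.cons true)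

/-- The number `.wt` whose binary expansion is the finite word `w` followed by the binary expansion
of `t ∈ [0,1]`. As `t` runs through `[0,1]`, it runs through the standard dyadic interval of `w`. -/
noncomputable def binaryPoint : List Bool → ℝ → ℝ
  | [], t => t
  | b :: w, t => ((if b then 1 else 0) + binaryPoint w t) / 2

/-- A tree diagram `(T₊, T₋)`: two planar binary rooted trees with equally many leaves. -/
structure TreeDiagram where
  top : BinaryTree Unit
  bot : BinaryTree Unit
  numLeaves_eq : top.numLeaves = bot.numLeaves

/-- A tree diagram represents `f` if `f` sends `.αt` to `.βt` whenever `α` is the `i`-th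
leaf of the top tree and `β` is the `i`-th leaf of the bottom tree. -/
def TreeDiagram.Represents (D : TreeDiagram) (f : unitInterval ≃ₜ unitInterval) : Prop :=
  ∀ p ∈ (leafWords D.top).zip (leafWords D.bot), ∀ t ∈ Set.Icc (0 : ℝ) 1, ∀ x : unitInterval,
    (x : ℝ) = binaryPoint p.1 t → (f x : ℝ) = binaryPoint p.2 t

/-- The reduced tree diagram of `f`: the one with the fewest leaves (hence with the fewest
vertices) among those representing `f`. -/
def TreeDiagram.IsReducedFor (D : TreeDiagram) (f : unitInterval ≃ₜ unitInterval) : Prop :=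
  D.Represents f ∧ ∀ E : TreeDiagram, E.Represents f → D.top.numLeaves ≤ E.top.numLeaves

/-! ### The strip of a tree diagram

The leaves, numbered `0, …, n - 1`, sit on the horizontal axis, the top tree lies above the axis
and is joined to the upper boundary of the strip by an edge at its root, and the bottom tree lies,
upside down, below the axis and is joined to the lower boundary by an edge at its root. Each region
of the strip meets the axis in exactly one of the `n + 1` gaps that the leaves leave on it, where
gap `i` is just to the left of leaf `i` and gap `n` is to the right of all leaves. So the regions
are numbered `0, …, n`. -/

/-- The edges of a tree, whose leftmost leaf has number `i`, including the edge above its root.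
Each edge is recorded by the numbers of the regions to its left and to its right: if the leaves
below the edge are `j, …, j + m - 1`, these are `j` and `j + m`. -/
def treeEdges : BinaryTree Unit → ℕ → List (ℕ × ℕ)
  | .nil, i => [(i, i + 1)]
  | .node a l r, i => (i, i + (BinaryTree.node a l r).numLeaves) ::
      (treeEdges l i ++ treeEdges r (i + l.numLeaves))

/-- The graph on the regions of the strip of a tree diagram, where two regions are adjacent if they
share an edge of the diagram. -/
def TreeDiagram.regionGraph (D : TreeDiagram) : SimpleGraph (Fin (D.top.numLeaves + 1)) :=
  SimpleGraph.fromRel fun i j =>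
    ((i : ℕ), (j : ℕ)) ∈ treeEdges D.top 0 ∨ ((i : ℕ), (j : ℕ)) ∈ treeEdges D.bot 0

/-- An element of `F` is `3`-colorable if the regions of the strip of its reduced tree diagram can
be colored with `3` colors so that regions sharing an edge have different colors. -/
def IsThreeColorable (f : thompsonF) : Prop :=
  ∃ D : TreeDiagram, D.IsReducedFor f ∧ D.regionGraph.Colorable 3

/-!
An element of `F` is `3`-colorable if and only if all its slopes are powers of `4`. Indeed, color the
regions of the strip by `ZMod 3`. Around a vertex of a tree the three colors are distinct exactly
when crossing either of the two lower edges changes the color by minus the change across the upper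
edge. So a proper coloring of the regions of one tree changes across a leaf of depth `d` by
`(-1) ^ d * s`, where `s` is the difference of the colors of the two outermost regions
(`forall_treeEdges_iff`). The two outermost regions are the same for both trees of a diagram, hence
a common proper coloring exists if and only if matching leaves have depths of equal parity. The slope
of `f` on the interval of a leaf is `2` to the difference of the depths of the matching leaves, so
this says that all slopes are powers of `4` (`isThreeColorable_iff`). This is a condition independent
of the chosen diagram, and by the chain rule it defines a subgroup (`evenSlopeSubgroup`). Every
element of `F` has a tree diagram at all because a fine enough subdivision of `[0,1]` is mapped to a
subdivision into standard dyadic intervals, and each such subdivision consists of the leaves of a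
tree (`Tiles.exists_leafWords_eq`).

Let `g` be in the commensurator and `u = g⁻¹`. Each `h` with even slopes has a positive power that
`u` conjugates to an element with even slopes. Suppose that the parity of the exponent of the slope
of `u` changed at a dyadic point `p`. A bump `h` with slopes `1`, `4`, `1/4`, supported near `p`, has
all its positive powers move points slightly to the left of `p` to points slightly to its right, so
there the conjugate by `u` of each of these powers has a slope that is an odd power of `2`, which is
impossible (`even_sub_of_conj`). So the parity is constant. It is not odd throughout: the sum over
the leaves of `(-1) ^ depth` is `1` modulo `3` for every tree (`sum_leafSigns`), whereas with odd
slopes throughout the sums of the two trees of a diagram of `u` would be opposite. Hence `u`, and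
with it `g`, has even slopes.
-/

/-! ### Slopes -/

/-- On `[a, b]`, the homeomorphism `f` is affine with slope `2 ^ k`. -/
def HasSlopeOn (f : unitInterval ≃ₜ unitInterval) (k : ℤ) (a b : unitInterval) : Prop :=
  ∃ c : ℝ, ∀ x ∈ Set.Icc a b, (f x : ℝ) = 2 ^ k * (x : ℝ) + c

theorem HasSlopeOn.mono {f : unitInterval ≃ₜ unitInterval} {k : ℤ} {a b a' b' : unitInterval}
    (h : HasSlopeOn f k a b) (ha : a ≤ a') (hb : b' ≤ b) : HasSlopeOn f k a' b' := by
  obtain ⟨c, hc⟩ := h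
  exact ⟨c, fun x hx => hc x ⟨ha.trans hx.1, hx.2.trans hb⟩⟩

theorem HasSlopeOn.unique {f : unitInterval ≃ₜ unitInterval} {k l : ℤ} {a b : unitInterval}
    (hab : a < b) (hk : HasSlopeOn f k a b) (hl : HasSlopeOn f l a b) : k = l := by
  obtain ⟨c, hc⟩ := hk
  obtain ⟨d, hd⟩ := hl
  have h1 := hc a ⟨le_rfl, hab.le⟩
  have h2 := hc b ⟨hab.le, le_rfl⟩
  have h3 := hd a ⟨le_rfl, hab.le⟩
  have h4 := hd b ⟨hab.le, le_rfl⟩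
  have hpos : (0 : ℝ) < b - a := sub_pos.2 hab
  have h5 : (2 : ℝ) ^ k * (b - a) = 2 ^ l * (b - a) := by linarith
  exact zpow_right_injective₀ two_pos (by norm_num) (mul_right_cancel₀ hpos.ne' h5)

theorem HasSlopeOn.mul {f g : unitInterval ≃ₜ unitInterval} {k l : ℤ} {a b : unitInterval}
    (hf : StrictMono f) (hg : HasSlopeOn g l (f a) (f b)) (h : HasSlopeOn f k a b) :
    HasSlopeOn (g * f) (l + k) a b := by
  obtain ⟨c, hc⟩ := h
  obtain ⟨d, hd⟩ := hg
  refine ⟨2 ^ l * c + d, fun x hx => ?_⟩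
  rw [Homeomorph.mul_apply, hd _ ⟨hf.monotone hx.1, hf.monotone hx.2⟩, hc x hx,
    zpow_add₀ two_ne_zero]
  ring

theorem HasSlopeOn.inv {f : unitInterval ≃ₜ unitInterval} {k : ℤ} {a b : unitInterval}
    (hf : StrictMono f) (h : HasSlopeOn f k a b) : HasSlopeOn f⁻¹ (-k) (f a) (f b) := by
  obtain ⟨c, hc⟩ := h
  refine ⟨-(2 ^ (-k) * c), fun x hx => ?_⟩
  obtain ⟨y, rfl⟩ := f.surjective x
  rw [hc y ⟨hf.le_iff_le.1 hx.1, hf.le_iff_le.1 hx.2⟩,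
    show f⁻¹ (f y) = y from f.symm_apply_apply y, zpow_neg]
  field_simp
  ring

/-- A property `P` of slopes known away from a finite set of points yields, inside every
nondegenerate interval, a nondegenerate initial subinterval whose slope satisfies `P`. -/
theorem exists_hasSlopeOn_of_finset {f : unitInterval ≃ₜ unitInterval} {P : ℤ → Prop}
    (S : Finset unitInterval)
    (hS : ∀ a b : unitInterval, a < b → (∀ s ∈ S, s ∉ Set.Ioo a b) →
      ∃ k, P k ∧ HasSlopeOn f k a b) {a b : unitInterval} (hab : a < b) :
    ∃ b' k, a < b' ∧ b' ≤ b ∧ P k ∧ HasSlopeOn f k a b' := by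
  classical
  have hne : (insert b (S.filter (a < ·))).Nonempty := ⟨b, by simp⟩
  set b' := (insert b (S.filter (a < ·))).min' hne with hb'
  have hlt : a < b' := by
    rw [hb', Finset.lt_min'_iff]
    intro s hs
    rcases Finset.mem_insert.1 hs with rfl | hs
    · exact hab
    · exact (Finset.mem_filter.1 hs).2
  obtain ⟨k, hk, h⟩ := hS a b' hlt fun s hs hs' => absurd hs'.2
    (not_lt.2 (Finset.min'_le _ _ (Finset.mem_insert_of_mem (Finset.mem_filter.2 ⟨hs, hs'.1⟩))))
  exact ⟨b', k, hlt, Finset.min'_le _ _ (Finset.mem_insert_self _ _), hk, h⟩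

theorem IsThompson.exists_hasSlopeOn {f : unitInterval ≃ₜ unitInterval} (hf : IsThompson f)
    {a b : unitInterval} (hab : a < b) :
    ∃ b' k, a < b' ∧ b' ≤ b ∧ HasSlopeOn f k a b' := by
  obtain ⟨-, S, -, hS⟩ := hf
  obtain ⟨b', k, h1, h2, -, h3⟩ := exists_hasSlopeOn_of_finset (P := fun _ => True) S
    (fun a b h1 h2 => let ⟨k, hk⟩ := hS a b h1 h2; ⟨k, trivial, hk⟩) hab
  exact ⟨b', k, h1, h2, h3⟩

/-- Wherever `f` is affine with slope a power of `2`, the slope is a power of `4`. -/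
def HasEvenSlopes (f : unitInterval ≃ₜ unitInterval) : Prop :=
  ∀ a b k, a < b → HasSlopeOn f k a b → Even k

theorem HasEvenSlopes.of_finset {f : unitInterval ≃ₜ unitInterval} (S : Finset unitInterval)
    (hS : ∀ a b : unitInterval, a < b → (∀ s ∈ S, s ∉ Set.Ioo a b) →
      ∃ k, Even k ∧ HasSlopeOn f k a b) : HasEvenSlopes f := by
  intro a b k hab hk
  obtain ⟨b', l, h1, h2, h3, h4⟩ := exists_hasSlopeOn_of_finset S hS hab
  rwa [(hk.mono le_rfl h2).unique h1 h4]

/-- The elements of `F` all of whose slopes are powers of `4`. -/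
def evenSlopeSubgroup : Subgroup thompsonF where
  carrier := {f | HasEvenSlopes f}
  one_mem' := HasEvenSlopes.of_finset ∅ fun a b _ _ => ⟨0, by simp, 0, by simp⟩
  mul_mem' := by
    rintro ⟨g, hg⟩ ⟨f, hf⟩ eg ef a b k hab hk
    obtain ⟨b', l, h1, h2, h3⟩ := IsThompson.exists_hasSlopeOn hf hab
    obtain ⟨y, m, h4, h5, h6⟩ := IsThompson.exists_hasSlopeOn hg (hf.1 h1)
    obtain ⟨b'', rfl⟩ := f.surjective y
    have h7 : a < b'' := hf.1.lt_iff_lt.1 h4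
    have h8 : b'' ≤ b' := hf.1.le_iff_le.1 h5
    have h9 := h3.mono le_rfl h8
    rw [(hk.mono le_rfl (h8.trans h2)).unique h7 (h6.mul hf.1 h9)]
    exact (eg _ _ _ h4 h6).add (ef _ _ _ h7 h9)
  inv_mem' := by
    rintro ⟨f, hf⟩ ef a b k hab hk
    have hi : StrictMono (f⁻¹ : unitInterval ≃ₜ unitInterval) := (thompsonF.inv_mem hf).1
    have h := hk.inv hi
    rw [inv_inv] at h
    simpa using ef _ _ _ (hi hab) h

theorem mem_evenSlopeSubgroup {f : thompsonF} :
    f ∈ evenSlopeSubgroup ↔ HasEvenSlopes f := Iff.rfl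

/-! ### A bump with slopes `1`, `4` and `1/4` -/

/-- For `0 ≤ c ≤ c + e ≤ 1`, this is the identity outside `[c, c + e]`. On `[c, c + e]`, it is the
concave bijection with slopes `4`, `1`, `1/4` on consecutive intervals of lengths `3e/16`, `e/16`
and `3e/4`. -/
noncomputable def bumpFun (c e x : ℝ) : ℝ :=
  max x (min (4 * x - 3 * c) (min (x + 9 / 16 * e) (x / 4 + 3 / 4 * (c + e))))

theorem strictMono_bumpFun (c e : ℝ) : StrictMono (bumpFun c e) := by
  intro x y h
  refine max_lt_max h (lt_min (min_lt_of_left_lt ?_) (lt_min (min_lt_of_right_lt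
    (min_lt_of_left_lt ?_)) (min_lt_of_right_lt (min_lt_of_right_lt ?_)))) <;> linarith

theorem continuous_bumpFun (c e : ℝ) : Continuous (bumpFun c e) := by
  unfold bumpFun
  fun_prop

theorem bumpFun_of_le {c e x : ℝ} (h : x ≤ c ∨ c + e ≤ x) : bumpFun c e x = x := by
  refine max_eq_left ?_
  rcases h with h | h
  · exact min_le_of_left_le (by linarith)
  · exact min_le_of_right_le (min_le_of_right_le (by linarith))

theorem bumpFun_of_slope_four {c e x : ℝ} (h1 : c ≤ x) (h2 : x ≤ c + 3 / 16 * e) :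
    bumpFun c e x = 4 * x - 3 * c := by
  unfold bumpFun
  rw [min_eq_left (le_min _ _), max_eq_right] <;> linarith

theorem bumpFun_of_slope_one {c e x : ℝ} (he : 0 ≤ e) (h1 : c + 3 / 16 * e ≤ x)
    (h2 : x ≤ c + 1 / 4 * e) : bumpFun c e x = x + 9 / 16 * e := by
  unfold bumpFun
  rw [min_eq_right (min_le_of_left_le _), min_eq_left, max_eq_right] <;> linarith

theorem bumpFun_of_slope_quarter {c e x : ℝ} (he : 0 ≤ e) (h1 : c + 1 / 4 * e ≤ x)
    (h2 : x ≤ c + e) : bumpFun c e x = x / 4 + 3 / 4 * (c + e) := by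
  unfold bumpFun
  rw [min_eq_right (min_le_of_right_le _), min_eq_right, max_eq_right] <;> linarith

theorem exists_homeomorph_bumpFun {c e : ℝ} (hc : 0 ≤ c) (hce : c + e ≤ 1) :
    ∃ h : unitInterval ≃ₜ unitInterval, StrictMono h ∧ ∀ x, (h x : ℝ) = bumpFun c e x := by
  have m := strictMono_bumpFun c e
  have e0 : bumpFun c e 0 = 0 := bumpFun_of_le (Or.inl hc)
  have e1 : bumpFun c e 1 = 1 := bumpFun_of_le (Or.inr hce)
  let F : unitInterval → unitInterval := fun x =>
    ⟨bumpFun c e x, by rw [← e0]; exact m.monotone x.2.1, by rw [← e1]; exact m.monotone x.2.2⟩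
  have mF : StrictMono F := fun x y h => m h
  have sF : Function.Surjective F := by
    intro y
    obtain ⟨x, hx, hxy⟩ := intermediate_value_Icc zero_le_one
      (continuous_bumpFun c e).continuousOn (show (y : ℝ) ∈ _ by rw [e0, e1]; exact y.2)
    exact ⟨⟨x, hx⟩, Subtype.ext hxy⟩
  exact ⟨(mF.orderIsoOfSurjective F sF).toHomeomorph, mF, fun x => rfl⟩

theorem exists_bump_mem_evenSlopeSubgroup {c e : ℝ} (hc : 0 ≤ c) (he : 0 ≤ e) (hce : c + e ≤ 1)
    (dc : IsDyadic c) (de : IsDyadic e) :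
    ∃ h ∈ evenSlopeSubgroup, ∀ x, (((h : thompsonF) : unitInterval ≃ₜ unitInterval) x : ℝ) =
      bumpFun c e x := by
  classical
  obtain ⟨h, mh, hh⟩ := exists_homeomorph_bumpFun hc hce
  let S : Finset unitInterval := {⟨c, hc, by linarith⟩, ⟨c + 3 / 16 * e, by linarith, by linarith⟩,
    ⟨c + 1 / 4 * e, by linarith, by linarith⟩, ⟨c + e, by linarith, hce⟩}
  have key : ∀ a b : unitInterval, a < b → (∀ s ∈ S, s ∉ Set.Ioo a b) →
      ∃ k, Even k ∧ HasSlopeOn h k a b := by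
    intro a b hab hs
    have split : ∀ s ∈ S, (b : ℝ) ≤ s ∨ (s : ℝ) ≤ a := by
      intro s h
      have := hs s h
      by_contra! h'
      exact this ⟨h'.2, h'.1⟩
    have s1 := split ⟨c, hc, by linarith⟩ (by simp [S])
    have s2 := split ⟨c + 3 / 16 * e, by linarith, by linarith⟩ (by simp [S])
    have s3 := split ⟨c + 1 / 4 * e, by linarith, by linarith⟩ (by simp [S])
    have s4 := split ⟨c + e, by linarith, hce⟩ (by simp [S])
    have hI : ∀ x ∈ Set.Icc a b, (a : ℝ) ≤ x ∧ (x : ℝ) ≤ b := fun x hx => hx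
    rcases s1 with s1 | s1
    · refine ⟨0, by simp, 0, fun x hx => ?_⟩
      rw [hh, bumpFun_of_le (Or.inl ((hI x hx).2.trans s1))]
      simp
    rcases s2 with s2 | s2
    · refine ⟨2, by simp, -3 * c, fun x hx => ?_⟩
      rw [hh, bumpFun_of_slope_four (s1.trans (hI x hx).1) ((hI x hx).2.trans s2)]
      norm_num
      ring
    rcases s3 with s3 | s3
    · refine ⟨0, by simp, 9 / 16 * e, fun x hx => ?_⟩
      rw [hh, bumpFun_of_slope_one he (s2.trans (hI x hx).1) ((hI x hx).2.trans s3)]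
      norm_num
    rcases s4 with s4 | s4
    · refine ⟨-2, by simp, 3 / 4 * (c + e), fun x hx => ?_⟩
      rw [hh, bumpFun_of_slope_quarter he (s3.trans (hI x hx).1) ((hI x hx).2.trans s4)]
      norm_num
      ring
    · refine ⟨0, by simp, 0, fun x hx => ?_⟩
      rw [hh, bumpFun_of_le (Or.inr (s4.trans (hI x hx).1))]
      simp
  have hT : IsThompson h := by
    refine ⟨mh, S, ?_, fun a b hab hs => let ⟨k, _, hk⟩ := key a b hab hs; ⟨k, hk⟩⟩
    have d1 : IsDyadic (c + 3 / 16 * e) := by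
      obtain ⟨m, n, rfl⟩ := de
      exact dc.add ⟨3 * m, n + 4, by push_cast; field_simp; ring⟩
    have d2 : IsDyadic (c + 1 / 4 * e) := by
      obtain ⟨m, n, rfl⟩ := de
      exact dc.add ⟨m, n + 2, by field_simp; ring⟩
    have d3 := dc.add de
    intro s hs
    simp only [S, Finset.mem_insert, Finset.mem_singleton] at hs
    rcases hs with rfl | rfl | rfl | rfl <;> assumption
  exact ⟨⟨h, hT⟩, HasEvenSlopes.of_finset S key, hh⟩

/-- There is an element with even slopes all of whose positive powers move `p` to the right, but not
beyond `b`. -/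
theorem exists_mem_evenSlopeSubgroup_lt {a p b : unitInterval} (hp : IsDyadic p) (ha : a < p)
    (hb : p < b) : ∃ h ∈ evenSlopeSubgroup, ∀ n, 0 < n →
      p < ((h ^ n : thompsonF) : unitInterval ≃ₜ unitInterval) p ∧
      ((h ^ n : thompsonF) : unitInterval ≃ₜ unitInterval) p ≤ b := by
  obtain ⟨n, hn⟩ : ∃ n : ℕ, (1 / 2 : ℝ) ^ n < min ((p : ℝ) - a) (b - p) :=
    exists_pow_lt_of_lt_one (lt_min (sub_pos.2 ha) (sub_pos.2 hb)) (by norm_num)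
  rw [lt_min_iff] at hn
  set d : ℝ := (1 / 2) ^ n with hd
  have d0 : 0 < d := by positivity
  have dd : IsDyadic d := ⟨1, n, by simp [hd]⟩
  have a0 := a.2.1
  have b1 := b.2.2
  -- The bump on `[p - d, p + d]` moves its midpoint `p`.
  obtain ⟨h, hC, hh⟩ := exists_bump_mem_evenSlopeSubgroup (c := p - d) (e := 2 * d)
    (by linarith) (by linarith) (by linarith)
    (by rw [sub_eq_add_neg]; exact hp.add dd.neg) (by rw [two_mul]; exact dd.add dd)
  refine ⟨h, hC, fun n hn0 => ?_⟩
  have mono : StrictMono (h : unitInterval ≃ₜ unitInterval) := h.2.1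
  have h1 : p < (h : unitInterval ≃ₜ unitInterval) p := by
    change (p : ℝ) < _
    rw [hh, bumpFun_of_slope_quarter] <;> linarith
  have h2 : (h : unitInterval ≃ₜ unitInterval) b = b := by
    apply Subtype.ext
    rw [hh, bumpFun_of_le (Or.inr (by linarith))]
  induction n, hn0 using Nat.le_induction with
  | base =>
    simp only [Nat.succ_eq_add_one, zero_add, pow_one]
    refine ⟨h1, ?_⟩
    conv_rhs => rw [← h2]
    exact mono.monotone hb.le
  | succ n _ ih =>
    rw [pow_succ']
    refine ⟨h1.trans (mono ih.1), ?_⟩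
    conv_rhs => rw [← h2]
    exact mono.monotone ih.2

/-! ### Standard dyadic intervals -/

theorem binaryPoint_eq (w : List Bool) (t : ℝ) :
    binaryPoint w t = binaryPoint w 0 + t / 2 ^ w.length := by
  induction w with
  | nil => simp [binaryPoint]
  | cons b w ih =>
    rw [binaryPoint, binaryPoint, ih, List.length_cons, pow_succ]
    field_simp
    ring

theorem binaryPoint_one (w : List Bool) :
    binaryPoint w 1 = binaryPoint w 0 + 1 / 2 ^ w.length := binaryPoint_eq w 1

theorem binaryPoint_append (v w : List Bool) (t : ℝ) :
    binaryPoint (v ++ w) t = binaryPoint v (binaryPoint w t) := by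
  induction v with
  | nil => rfl
  | cons b v ih => rw [List.cons_append, binaryPoint, binaryPoint, ih]

theorem binaryPoint_mem_Icc (w : List Bool) {t : ℝ} (ht : t ∈ Set.Icc (0 : ℝ) 1) :
    binaryPoint w t ∈ Set.Icc (0 : ℝ) 1 := by
  induction w with
  | nil => exact ht
  | cons b w ih =>
    obtain ⟨h0, h1⟩ := ih
    cases b <;> simp only [binaryPoint] <;> constructor <;> norm_num <;> linarith

theorem binaryPoint_zero_lt_one (w : List Bool) : binaryPoint w 0 < binaryPoint w 1 := by
  rw [binaryPoint_one]
  exact lt_add_of_pos_right _ (by positivity)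

/-- The left endpoint of the interval of a word of length `n` is a multiple of `2 ^ (-n)`. -/
theorem exists_binaryPoint_zero_eq (w : List Bool) :
    ∃ m : ℤ, binaryPoint w 0 = m / 2 ^ w.length := by
  induction w with
  | nil => exact ⟨0, by simp [binaryPoint]⟩
  | cons b w ih =>
    obtain ⟨m, hm⟩ := ih
    refine ⟨(if b then 2 ^ w.length else 0) + m, ?_⟩
    rw [binaryPoint, hm, List.length_cons, pow_succ]
    cases b <;> simp <;> field_simp

theorem exists_word_of_lt (r J : ℕ) (h : J < 2 ^ r) :
    ∃ w : List Bool, w.length = r ∧ binaryPoint w 0 = J / 2 ^ r := by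
  induction r generalizing J with
  | zero => exact ⟨[], rfl, by simp at h; simp [binaryPoint, h]⟩
  | succ r ih =>
    rcases lt_or_ge J (2 ^ r) with h' | h'
    · obtain ⟨w, hw, e⟩ := ih J h'
      refine ⟨false :: w, by simp [hw], ?_⟩
      rw [binaryPoint, e, pow_succ]
      simp
      field_simp
    · obtain ⟨w, hw, e⟩ := ih (J - 2 ^ r) (by rw [pow_succ] at h; omega)
      refine ⟨true :: w, by simp [hw], ?_⟩
      rw [binaryPoint, e, pow_succ, Nat.cast_sub h']
      push_cast
      field_simp
      simp

/-- The point `.wt` of the unit interval, for `t ∈ [0,1]`. -/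
noncomputable def unitPoint (w : List Bool) (t : unitInterval) : unitInterval :=
  ⟨binaryPoint w t, binaryPoint_mem_Icc w t.2⟩

theorem unitPoint_zero_lt_one (w : List Bool) : unitPoint w 0 < unitPoint w 1 :=
  binaryPoint_zero_lt_one w

theorem isDyadic_unitPoint_zero (w : List Bool) : IsDyadic (unitPoint w 0) := by
  obtain ⟨m, hm⟩ := exists_binaryPoint_zero_eq w
  exact ⟨m, w.length, hm⟩

theorem isDyadic_unitPoint_one (w : List Bool) : IsDyadic (unitPoint w 1) := by
  obtain ⟨m, hm⟩ := exists_binaryPoint_zero_eq w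
  refine ⟨m + 1, w.length, ?_⟩
  simp only [unitPoint, Set.Icc.coe_one, binaryPoint_one, hm]
  push_cast
  ring

theorem exists_unitPoint_eq {w : List Bool} {x : unitInterval}
    (hx : x ∈ Set.Icc (unitPoint w 0) (unitPoint w 1)) : ∃ t, x = unitPoint w t := by
  have h0 : binaryPoint w 0 ≤ x := hx.1
  have h1 : (x : ℝ) ≤ binaryPoint w 1 := hx.2
  rw [binaryPoint_one] at h1
  have hpos : (0 : ℝ) < 2 ^ w.length := by positivity
  refine ⟨⟨((x : ℝ) - binaryPoint w 0) * 2 ^ w.length, mul_nonneg (by linarith) hpos.le, ?_⟩, ?_⟩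
  · rw [← le_div_iff₀ hpos]
    linarith
  · apply Subtype.ext
    simp only [unitPoint]
    rw [binaryPoint_eq, mul_div_cancel_right₀ _ hpos.ne']
    ring

/-- `f` maps the standard dyadic interval of `v` affinely onto that of `w`. -/
def MapsWord (f : unitInterval ≃ₜ unitInterval) (v w : List Bool) : Prop :=
  ∀ t, f (unitPoint v t) = unitPoint w t

theorem MapsWord.hasSlopeOn {f : unitInterval ≃ₜ unitInterval} {v w : List Bool}
    (h : MapsWord f v w) :
    HasSlopeOn f (v.length - w.length) (unitPoint v 0) (unitPoint v 1) := by
  refine ⟨binaryPoint w 0 - 2 ^ (v.length - w.length : ℤ) * binaryPoint v 0, fun x hx => ?_⟩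
  obtain ⟨t, rfl⟩ := exists_unitPoint_eq hx
  rw [h t]
  simp only [unitPoint]
  rw [binaryPoint_eq w, binaryPoint_eq v, zpow_sub₀ two_ne_zero, zpow_natCast, zpow_natCast]
  field_simp
  ring

theorem TreeDiagram.represents_iff (D : TreeDiagram) (f : unitInterval ≃ₜ unitInterval) :
    D.Represents f ↔ ∀ p ∈ (leafWords D.top).zip (leafWords D.bot), MapsWord f p.1 p.2 := by
  refine forall₂_congr fun p _ => ⟨fun h t => Subtype.ext (h t t.2 _ rfl), fun h t ht x hx => ?_⟩
  have := h ⟨t, ht⟩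
  rw [← show x = unitPoint p.1 ⟨t, ht⟩ from Subtype.ext hx] at this
  rw [this]
  rfl

/-! ### Leaves of trees and subdivisions of `[0,1]` -/

theorem length_leafWords (T : BinaryTree Unit) : (leafWords T).length = T.numLeaves := by
  induction T with
  | nil => rfl
  | node _ l r ihl ihr => simp [leafWords, BinaryTree.numLeaves, ihl, ihr]

/-- The standard dyadic intervals of the words in the list subdivide `[a, b]`, in this order. -/
def Tiles : ℝ → List (List Bool) → ℝ → Prop
  | a, [], b => a = b
  | a, w :: L, b => a = binaryPoint w 0 ∧ Tiles (binaryPoint w 1) L b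

theorem Tiles.append {L M : List (List Bool)} {a b c : ℝ} (h : Tiles a L b) (h' : Tiles b M c) :
    Tiles a (L ++ M) c := by
  induction L generalizing a with
  | nil => rwa [show a = b from h]
  | cons w L ih => exact ⟨h.1, ih h.2⟩

theorem Tiles.map_cons {L : List (List Bool)} {a b : ℝ} (x : Bool) (h : Tiles a L b) :
    Tiles (((if x then 1 else 0) + a) / 2) (L.map (List.cons x))
      (((if x then 1 else 0) + b) / 2) := by
  induction L generalizing a with
  | nil => rw [show a = b from h]; rfl
  | cons w L ih => exact ⟨by rw [h.1]; rfl, ih h.2⟩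

theorem tiles_leafWords (T : BinaryTree Unit) : Tiles 0 (leafWords T) 1 := by
  induction T with
  | nil => exact ⟨rfl, rfl⟩
  | node _ l r ihl ihr =>
    have h1 := ihl.map_cons false
    have h2 := ihr.map_cons true
    norm_num at h1 h2
    exact h1.append h2

theorem Tiles.le {L : List (List Bool)} {a b : ℝ} (h : Tiles a L b) : a ≤ b := by
  induction L generalizing a with
  | nil => exact le_of_eq h
  | cons w L ih => rw [h.1]; exact (binaryPoint_zero_lt_one w).le.trans (ih h.2)

theorem Tiles.eq_nil {L : List (List Bool)} {a : ℝ} (h : Tiles a L a) : L = [] := by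
  cases L with
  | nil => rfl
  | cons w L =>
    have h1 := h.2.le
    have h2 := binaryPoint_zero_lt_one w
    rw [← h.1] at h2
    exact absurd h1 (not_le.2 h2)

/-- If the empty word occurs in a subdivision of a part of `[0,1]`, it is the only word. -/
theorem Tiles.eq_singleton_nil {L : List (List Bool)} {a : ℝ} (ha : 0 ≤ a) (h : Tiles a L 1)
    (hL : [] ∈ L) : L = [[]] := by
  obtain ⟨s, t, rfl⟩ := List.append_of_mem hL
  have key : ∀ (s : List (List Bool)) (a : ℝ), 0 ≤ a → Tiles a (s ++ [] :: t) 1 → s = [] := by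
    intro s
    induction s with
    | nil => intros; rfl
    | cons w s ih =>
      intro a ha h
      have hw := binaryPoint_zero_lt_one w
      have hw0 : 0 < binaryPoint w 1 := by rw [← h.1] at hw; exact ha.trans_lt hw
      obtain rfl := ih _ hw0.le h.2
      exact absurd h.2.1 hw0.ne'
  obtain rfl := key s a ha h
  rw [(h.2 : Tiles 1 t 1).eq_nil]
  rfl

/-- A subdivision of `[a, 1]` by intervals other than `[0,1]` splits at `1 / 2`. -/
theorem Tiles.split {L : List (List Bool)} {a : ℝ} (ha : a ≤ 1 / 2) (hL : [] ∉ L)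
    (h : Tiles a L 1) : ∃ M N : List (List Bool),
      L = M.map (List.cons false) ++ N.map (List.cons true) ∧ Tiles (2 * a) M 1 ∧ Tiles 0 N 1 := by
  have right : ∀ (L : List (List Bool)) (a : ℝ), 1 / 2 ≤ a → [] ∉ L → Tiles a L 1 →
      ∃ N : List (List Bool), L = N.map (List.cons true) ∧ Tiles (2 * a - 1) N 1 := by
    intro L
    induction L with
    | nil =>
      intro a _ _ h
      exact ⟨[], rfl, by rw [show a = 1 from h]; norm_num [Tiles]⟩
    | cons w L ih =>
      intro a ha hL h
      have h' := h.1
      match w with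
      | [] => simp at hL
      | false :: w =>
        have h1 := binaryPoint_zero_lt_one w
        have h2 := (binaryPoint_mem_Icc w (t := 1) (by simp)).2
        simp [binaryPoint] at h'
        linarith
      | true :: w =>
        have h1 := binaryPoint_zero_lt_one (true :: w)
        obtain ⟨N, rfl, hN⟩ := ih _ (by linarith [h.1]) (fun h => hL (by simp [h])) h.2
        refine ⟨w :: N, rfl, ?_, ?_⟩
        · rw [h', binaryPoint]
          norm_num
          ring
        · convert hN using 1
          rw [binaryPoint]
          norm_num
          ring
  induction L generalizing a with
  | nil => norm_num [show a = 1 from h] at ha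
  | cons w L ih =>
    have h' := h.1
    match w with
    | [] => simp at hL
    | true :: w =>
      have h1 := (binaryPoint_mem_Icc w (t := 0) (by simp)).1
      have : a = 1 / 2 := by
        simp [binaryPoint] at h'
        linarith
      subst this
      obtain ⟨N, e, hN⟩ := right _ _ le_rfl hL h
      refine ⟨[], N, e, ?_, ?_⟩
      · norm_num [Tiles]
      · norm_num at hN
        exact hN
    | false :: w =>
      have h1 := (binaryPoint_mem_Icc w (t := 1) (by simp)).2
      have h2 : binaryPoint (false :: w) 1 = binaryPoint w 1 / 2 := by simp [binaryPoint]
      obtain ⟨M, N, rfl, hM, hN⟩ := ih (by rw [h2]; linarith) (fun h => hL (by simp [h])) h.2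
      refine ⟨w :: M, N, rfl, ⟨?_, ?_⟩, hN⟩
      · rw [h', binaryPoint]
        norm_num
        ring
      · convert hM using 1
        rw [h2]
        ring

/-- Every subdivision of `[0,1]` into standard dyadic intervals consists of the leaves of a
tree. -/
theorem Tiles.exists_leafWords_eq {L : List (List Bool)} (h : Tiles 0 L 1) :
    ∃ T, leafWords T = L := by
  obtain ⟨n, hn⟩ : ∃ n, ∀ w ∈ L, w.length ≤ n :=
    ⟨(L.map List.length).sum, fun w hw => List.single_le_sum (by simp) _ (List.mem_map_of_mem hw)⟩
  induction n generalizing L with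
  | zero =>
    match L, h, hn with
    | [], h, _ => exact absurd h zero_ne_one
    | w :: L, h, hn =>
      have : w = [] := by simpa using hn w (by simp)
      subst this
      exact ⟨.nil, (h.eq_singleton_nil le_rfl (by simp)).symm⟩
  | succ n ih =>
    by_cases hL : [] ∈ L
    · exact ⟨.nil, (h.eq_singleton_nil le_rfl hL).symm⟩
    · obtain ⟨M, N, rfl, hM, hN⟩ := h.split (by norm_num) hL
      rw [mul_zero] at hM
      obtain ⟨l, rfl⟩ := ih hM fun w hw => by
        simpa using hn (false :: w) (by simp [hw])
      obtain ⟨r, rfl⟩ := ih hN fun w hw => by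
        simpa using hn (true :: w) (by simp [hw])
      exact ⟨.node () l r, rfl⟩

/-- The half-open intervals of a subdivision cover the subdivided interval. -/
theorem Tiles.exists_mem {L : List (List Bool)} {a b x : ℝ} (h : Tiles a L b) (ha : a ≤ x)
    (hb : x < b) : ∃ w ∈ L, binaryPoint w 0 ≤ x ∧ x < binaryPoint w 1 := by
  induction L generalizing a with
  | nil =>
    rw [show a = b from h] at ha
    exact absurd hb (not_lt.2 ha)
  | cons w L ih =>
    rcases lt_or_ge x (binaryPoint w 1) with hx | hx
    · exact ⟨w, by simp, h.1 ▸ ha, hx⟩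
    · obtain ⟨v, hv, h'⟩ := ih h.2 hx
      exact ⟨v, by simp [hv], h'⟩

theorem Tiles.isChain {L : List (List Bool)} {a b : ℝ} (h : Tiles a L b) :
    L.IsChain fun v w => unitPoint v 1 = unitPoint w 0 := by
  induction L generalizing a with
  | nil => exact .nil
  | cons v L ih =>
    cases L with
    | nil => exact .singleton _
    | cons w L => exact .cons_cons (Subtype.ext h.2.1) (ih h.2)

theorem Tiles.map_of_mapsWord {f : unitInterval ≃ₜ unitInterval} {β : List Bool → List Bool}
    {L : List (List Bool)} (hL : ∀ w ∈ L, MapsWord f w (β w)) {a b : unitInterval}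
    (h : Tiles a L b) : Tiles (f a) (L.map β) (f b) := by
  induction L generalizing a with
  | nil => rw [show a = b from Subtype.ext h]; rfl
  | cons w L ih =>
    have hw := hL w (by simp)
    refine ⟨?_, ?_⟩
    · rw [show a = unitPoint w 0 from Subtype.ext h.1, hw 0]
      rfl
    · have := ih (fun v hv => hL v (by simp [hv])) (a := unitPoint w 1) h.2
      rwa [hw 1] at this

/-! ### Existence of tree diagrams -/

/-- A property of words that passes from both children to their parent holds for `w` as soon as it
holds for all descendants of `w` in some fixed generation. -/
theorem forall_word_of_children {P : List Bool → Prop}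
    (hP : ∀ w, P (w ++ [false]) → P (w ++ [true]) → P w) (n : ℕ) (w : List Bool)
    (h : ∀ v : List Bool, v.length = n → P (w ++ v)) : P w := by
  induction n generalizing w with
  | zero => simpa using h [] rfl
  | succ n ih =>
    refine hP w (ih _ fun v hv => ?_) (ih _ fun v hv => ?_)
    · simpa using h (false :: v) (by simp [hv])
    · simpa using h (true :: v) (by simp [hv])

/-- The interval of `w` can be subdivided by a tree into standard dyadic intervals each of which
`f` maps affinely onto a standard dyadic interval. -/
def Resolvable (f : unitInterval ≃ₜ unitInterval) (w : List Bool) : Prop :=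
  ∃ T, ∀ v ∈ leafWords T, ∃ u, MapsWord f (w ++ v) u

theorem Resolvable.of_children {f : unitInterval ≃ₜ unitInterval} (w : List Bool)
    (h0 : Resolvable f (w ++ [false])) (h1 : Resolvable f (w ++ [true])) : Resolvable f w := by
  obtain ⟨l, hl⟩ := h0
  obtain ⟨r, hr⟩ := h1
  refine ⟨.node () l r, fun v hv => ?_⟩
  simp only [leafWords, List.mem_append, List.mem_map] at hv
  rcases hv with ⟨v, hv, rfl⟩ | ⟨v, hv, rfl⟩
  · simpa using hl v hv
  · simpa using hr v hv

/-- If `f` is affine on the interval of `w`, then it maps every sufficiently small standard dyadic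
subinterval onto a standard dyadic interval. -/
theorem IsThompson.resolvable_of_hasSlopeOn {f : unitInterval ≃ₜ unitInterval} (hf : IsThompson f)
    {w : List Bool} {k : ℤ} (h : HasSlopeOn f k (unitPoint w 0) (unitPoint w 1)) :
    Resolvable f w := by
  obtain ⟨c, hc⟩ := h
  have hle : unitPoint w 0 ≤ unitPoint w 1 := (unitPoint_zero_lt_one w).le
  have dc : IsDyadic c := by
    have h1 := (isDyadic_unitPoint_zero w)
    have h2 := (hf.isDyadic_iff _).2 h1
    have h3 := h2.add (h1.zpow_mul k).neg
    rw [hc _ ⟨le_rfl, hle⟩] at h3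
    simpa using h3
  obtain ⟨m, q, rfl⟩ := dc
  -- Descending `q + k` generations makes `c = m / 2 ^ q` a multiple of the length of the images.
  refine forall_word_of_children Resolvable.of_children (q + k.toNat) w fun v hv => ⟨.nil, ?_⟩
  simp only [leafWords, List.mem_singleton, forall_eq, List.append_nil]
  set x := w ++ v with hx
  -- The image of the interval of `x` has length `2 ^ (-r)`.
  obtain ⟨r, hr⟩ : ∃ r : ℕ, (x.length : ℤ) = r + k := by
    refine ⟨(x.length - k).toNat, ?_⟩
    simp only [hx, List.length_append, hv]
    omega
  have hqr : q ≤ r := by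
    simp only [hx, List.length_append, hv] at hr
    omega
  have hmem : ∀ t, unitPoint x t ∈ Set.Icc (unitPoint w 0) (unitPoint w 1) := by
    intro t
    have hvt := binaryPoint_mem_Icc v t.2
    have e1 : (unitPoint x t : ℝ) = binaryPoint w 0 + binaryPoint v t / 2 ^ w.length := by
      simp only [unitPoint]
      rw [hx, binaryPoint_append, binaryPoint_eq]
    constructor
    · change binaryPoint w 0 ≤ (unitPoint x t : ℝ)
      rw [e1]
      exact le_add_of_nonneg_right (div_nonneg hvt.1 (by positivity))
    · change (unitPoint x t : ℝ) ≤ binaryPoint w 1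
      rw [e1, binaryPoint_one]
      gcongr
      exact hvt.2
  obtain ⟨j, hj⟩ := exists_binaryPoint_zero_eq x
  have hfx : ∀ t, (f (unitPoint x t) : ℝ) = ((j + m * 2 ^ (r - q) : ℤ) + t) / 2 ^ r := by
    intro t
    rw [hc _ (hmem t)]
    simp only [unitPoint]
    rw [binaryPoint_eq, hj]
    have e1 : (2 : ℝ) ^ x.length = 2 ^ r * 2 ^ k := by
      rw [← zpow_natCast, hr, zpow_add₀ two_ne_zero, zpow_natCast]
    have e2 : (2 : ℝ) ^ r = 2 ^ (r - q) * 2 ^ q := by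
      rw [← pow_add, Nat.sub_add_cancel hqr]
    rw [e1]
    push_cast
    have e3 : (m : ℝ) / 2 ^ q = m * 2 ^ (r - q) / 2 ^ r := by
      rw [e2]
      field_simp
    rw [e3]
    field_simp
    ring
  obtain ⟨J, hJ⟩ : ∃ J : ℕ, (j + m * 2 ^ (r - q) : ℤ) = J := by
    refine Int.eq_ofNat_of_zero_le ?_
    have h0 := (f (unitPoint x 0)).2.1
    rw [hfx, Set.Icc.coe_zero, add_zero, le_div_iff₀ (by positivity), zero_mul] at h0
    exact_mod_cast h0
  have hJr : J < 2 ^ r := by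
    have h1 := (f (unitPoint x 1)).2.2
    rw [hfx, Set.Icc.coe_one, hJ, div_le_one (by positivity)] at h1
    exact_mod_cast h1
  obtain ⟨u, hu, hu'⟩ := exists_word_of_lt r J hJr
  refine ⟨u, fun t => Subtype.ext ?_⟩
  rw [hfx, hJ]
  simp only [unitPoint]
  rw [binaryPoint_eq, hu', hu, add_div]
  simp

theorem exists_forall_eq_div_two_pow (S : Finset unitInterval) (hS : ∀ s ∈ S, IsDyadic s) :
    ∃ n : ℕ, ∀ s ∈ S, ∃ m : ℤ, (s : ℝ) = m / 2 ^ n := by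
  classical
  induction S using Finset.induction_on with
  | empty => exact ⟨0, by simp⟩
  | insert s S _ ih =>
    obtain ⟨n, hn⟩ := ih fun t ht => hS t (by simp [ht])
    obtain ⟨m', n', hs⟩ := hS s (by simp)
    refine ⟨n + n', fun t ht => ?_⟩
    rcases Finset.mem_insert.1 ht with rfl | ht
    · exact ⟨m' * 2 ^ n, by rw [hs, pow_add]; push_cast; field_simp⟩
    · obtain ⟨m, hm⟩ := hn t ht
      exact ⟨m * 2 ^ n', by rw [hm, pow_add]; push_cast; field_simp⟩

theorem IsThompson.resolvable_nil {f : unitInterval ≃ₜ unitInterval} (hf : IsThompson f) :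
    Resolvable f [] := by
  obtain ⟨S, hS, hA⟩ := hf.2
  obtain ⟨n, hn⟩ := exists_forall_eq_div_two_pow S hS
  refine forall_word_of_children Resolvable.of_children n [] fun v hv => ?_
  rw [List.nil_append]
  obtain ⟨k, hk⟩ := hA (unitPoint v 0) (unitPoint v 1) (unitPoint_zero_lt_one v) (by
    rintro s hs ⟨h0, h1⟩
    obtain ⟨m, hm⟩ := hn s hs
    obtain ⟨j, hj⟩ := exists_binaryPoint_zero_eq v
    replace h0 : binaryPoint v 0 < s := h0
    replace h1 : s < binaryPoint v 1 := h1
    rw [binaryPoint_one, hj, hm, hv, ← add_div, div_lt_div_iff_of_pos_right (by positivity)] at h1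
    rw [hj, hm, hv, div_lt_div_iff_of_pos_right (by positivity)] at h0
    have h0' : j < m := by exact_mod_cast h0
    have h1' : m < j + 1 := by exact_mod_cast h1
    omega)
  exact hf.resolvable_of_hasSlopeOn hk

theorem IsThompson.exists_represents {f : unitInterval ≃ₜ unitInterval} (hf : IsThompson f) :
    ∃ D : TreeDiagram, D.Represents f := by
  classical
  obtain ⟨T, hT⟩ := hf.resolvable_nil
  have hT' : ∀ v, ∃ u, v ∈ leafWords T → MapsWord f v u := fun v => by
    by_cases hv : v ∈ leafWords T
    · obtain ⟨u, hu⟩ := hT v hv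
      exact ⟨u, fun _ => hu⟩
    · exact ⟨[], fun h => absurd h hv⟩
  choose β hβ using hT'
  have h1 : f 1 = 1 := by
    obtain ⟨x, hx⟩ := f.surjective 1
    exact le_antisymm unitInterval.le_one'
      (hx.symm.le.trans (hf.1.monotone unitInterval.le_one'))
  have h := Tiles.map_of_mapsWord hβ (a := 0) (b := 1) (tiles_leafWords T)
  rw [hf.map_zero, h1] at h
  obtain ⟨T', hT'⟩ := h.exists_leafWords_eq
  refine ⟨⟨T, T', ?_⟩, ?_⟩
  · rw [← length_leafWords, ← length_leafWords, hT', List.length_map]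
  · rw [TreeDiagram.represents_iff]
    simp only [hT']
    rw [List.zip_map_right]
    intro p hp
    obtain ⟨⟨v, w⟩, hq, rfl⟩ := List.mem_map.1 hp
    have hvw : v = w ∧ v ∈ leafWords T := by
      obtain ⟨i, hi, e⟩ := List.getElem_of_mem hq
      rw [List.getElem_zip, Prod.mk.injEq] at e
      obtain ⟨rfl, rfl⟩ := e
      exact ⟨rfl, List.getElem_mem _⟩
    obtain ⟨rfl, hv⟩ := hvw
    exact hβ v hv

theorem IsThompson.exists_isReducedFor {f : unitInterval ≃ₜ unitInterval} (hf : IsThompson f) :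
    ∃ D : TreeDiagram, D.IsReducedFor f := by
  obtain ⟨D, hD, hmin⟩ := exists_minimalFor_of_wellFoundedLT
    (fun D : TreeDiagram => D.Represents f) (fun D => D.top.numLeaves) hf.exists_represents
  exact ⟨D, hD, fun E hE => (le_total _ _).elim id fun h => hmin hE h⟩

/-- `f` has even slopes if and only if matching leaves of a tree diagram of `f` have depths of equal
parity. -/
theorem TreeDiagram.Represents.hasEvenSlopes_iff {D : TreeDiagram}
    {f : unitInterval ≃ₜ unitInterval} (h : D.Represents f) :
    HasEvenSlopes f ↔ ∀ p ∈ (leafWords D.top).zip (leafWords D.bot),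
      Even (p.1.length - p.2.length : ℤ) := by
  rw [TreeDiagram.represents_iff] at h
  refine ⟨fun hf p hp => hf _ _ _ (unitPoint_zero_lt_one _) (h p hp).hasSlopeOn, ?_⟩
  intro hp a b k hab hk
  obtain ⟨v, hv, h0, h1⟩ := (tiles_leafWords D.top).exists_mem a.2.1
    (lt_of_lt_of_le (show (a : ℝ) < b from hab) b.2.2)
  obtain ⟨i, hi, rfl⟩ := List.getElem_of_mem hv
  have hi' : i < (leafWords D.bot).length := by
    rwa [length_leafWords, ← D.numLeaves_eq, ← length_leafWords]
  have hmem : ((leafWords D.top)[i], (leafWords D.bot)[i]) ∈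
      (leafWords D.top).zip (leafWords D.bot) :=
    List.mem_iff_getElem.2 ⟨i, by simp [hi, hi'], by simp⟩
  have hlt : a < min b (unitPoint (leafWords D.top)[i] 1) := lt_min hab h1
  rw [(hk.mono le_rfl (min_le_left _ _)).unique hlt
    ((h _ hmem).hasSlopeOn.mono h0 (min_le_right _ _))]
  exact hp _ hmem

/-! ### Colorings -/

/-- The signs of the leaves of a tree from left to right, modulo `3`: a leaf of depth `d` has sign
`(-1) ^ d`. -/
def leafSigns (T : BinaryTree Unit) : List (ZMod 3) :=
  (leafWords T).map fun w => (-1) ^ w.length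

/-- The list of differences `c (j + 1) - c j` for `i ≤ j < i + n`: the changes of color across the
leaves `i, …, i + n - 1`. -/
def colorSteps (c : ℕ → ZMod 3) (i n : ℕ) : List (ZMod 3) :=
  (List.range' i n).map fun j => c (j + 1) - c j

theorem leafSigns_node (a : Unit) (l r : BinaryTree Unit) :
    leafSigns (.node a l r) = (leafSigns l).map (-·) ++ (leafSigns r).map (-·) := by
  simp [leafSigns, leafWords, pow_succ, Function.comp_def]

theorem sum_leafSigns (T : BinaryTree Unit) : (leafSigns T).sum = 1 := by
  induction T with
  | nil => simp [leafSigns, leafWords]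
  | node _ l r ihl ihr =>
    rw [leafSigns_node, List.sum_append, ← List.sum_neg, ← List.sum_neg, ihl, ihr]
    decide

theorem colorSteps_add (c : ℕ → ZMod 3) (i m n : ℕ) :
    colorSteps c i (m + n) = colorSteps c i m ++ colorSteps c (i + m) n := by
  rw [colorSteps, colorSteps, colorSteps, ← List.map_append, List.range'_append_1]

theorem sum_colorSteps (c : ℕ → ZMod 3) (i n : ℕ) :
    (colorSteps c i n).sum = c (i + n) - c i := by
  induction n with
  | zero => simp [colorSteps]
  | succ n ih =>
    rw [colorSteps_add, List.sum_append, ih]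
    simp [colorSteps, add_assoc]

/-- A coloring of the regions of a tree is proper if and only if its steps along the leaves are, up
to a common nonzero factor, the signs of the leaves: three colors around a vertex are distinct
precisely when crossing each lower edge changes the color by minus what crossing the upper edge
does. -/
theorem forall_treeEdges_iff (c : ℕ → ZMod 3) (T : BinaryTree Unit) (i : ℕ) :
    (∀ e ∈ treeEdges T i, c e.1 ≠ c e.2) ↔
      c (i + T.numLeaves) - c i ≠ 0 ∧ colorSteps c i T.numLeaves =
        (leafSigns T).map ((c (i + T.numLeaves) - c i) * ·) := by
  induction T generalizing i with
  | nil =>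
    simp [treeEdges, colorSteps, leafSigns, leafWords, BinaryTree.numLeaves, sub_eq_zero, eq_comm]
  | node _ l r ihl ihr =>
    -- The three regions around the root are `i`, `i + l.numLeaves` and the rightmost one.
    have key : ∀ x y z : ZMod 3, x ≠ z → y - x ≠ 0 → z - y ≠ 0 →
        y - x = -(z - x) ∧ z - y = -(z - x) := by decide
    have split : (∀ e ∈ treeEdges (.node () l r) i, c e.1 ≠ c e.2) ↔
        c i ≠ c (i + (l.numLeaves + r.numLeaves)) ∧ (∀ e ∈ treeEdges l i, c e.1 ≠ c e.2) ∧
          ∀ e ∈ treeEdges r (i + l.numLeaves), c e.1 ≠ c e.2 := by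
      simp only [treeEdges, List.forall_mem_cons, List.forall_mem_append, BinaryTree.numLeaves]
    rw [split, ihl, ihr]
    simp only [BinaryTree.numLeaves, leafSigns_node, colorSteps_add, ← add_assoc]
    set x := c i
    set y := c (i + l.numLeaves) with hy
    set z := c (i + l.numLeaves + r.numLeaves) with hz
    have hneg : ∀ (d : ZMod 3) (L : List (ZMod 3)),
        (L.map (-·)).map (d * ·) = L.map (-d * ·) := by
      intro d L
      simp [Function.comp_def]
    rw [List.map_append, hneg, hneg]
    constructor
    · rintro ⟨hxz, ⟨hl, hl'⟩, hr, hr'⟩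
      obtain ⟨e1, e2⟩ := key x y z hxz hl hr
      refine ⟨sub_ne_zero.2 hxz.symm, ?_⟩
      rw [hl', hr', e1, e2]
    · rintro ⟨hxz, h⟩
      obtain ⟨hl, hr⟩ := List.append_inj h (by simp [colorSteps, leafSigns, length_leafWords])
      have sl := congrArg List.sum hl
      have sr := congrArg List.sum hr
      rw [List.sum_map_mul_left, List.map_id', sum_leafSigns, sum_colorSteps, mul_one] at sl sr
      rw [← hy] at sl
      rw [← hz, ← hy] at sr
      refine ⟨(sub_ne_zero.1 hxz).symm, ⟨?_, ?_⟩, ?_, ?_⟩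
      · rw [sl]; exact neg_ne_zero.2 hxz
      · rw [sl]; exact hl
      · rw [sr]; exact neg_ne_zero.2 hxz
      · rw [sr]; exact hr

theorem exists_colorSteps_eq (L : List (ZMod 3)) :
    ∃ c : ℕ → ZMod 3, colorSteps c 0 L.length = L := by
  refine ⟨fun j => (L.take j).sum, List.ext_getElem (by simp [colorSteps]) fun j h1 h2 => ?_⟩
  simp [colorSteps, List.sum_take_succ _ _ h2]

theorem treeEdges_lt {T : BinaryTree Unit} {i : ℕ} {e : ℕ × ℕ} (he : e ∈ treeEdges T i) :
    e.1 < e.2 ∧ e.2 ≤ i + T.numLeaves := by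
  induction T generalizing i with
  | nil => simp [treeEdges] at he; simp [he, BinaryTree.numLeaves]
  | node a l r ihl ihr =>
    have := l.numLeaves_pos
    simp only [treeEdges, BinaryTree.numLeaves, List.mem_cons, List.mem_append] at he ⊢
    rcases he with rfl | he | he
    · simp; omega
    · have := ihl he; omega
    · have := ihr he; omega

theorem TreeDiagram.colorable_three_iff_exists (D : TreeDiagram) :
    D.regionGraph.Colorable 3 ↔ ∃ c : ℕ → ZMod 3,
      (∀ e ∈ treeEdges D.top 0, c e.1 ≠ c e.2) ∧ ∀ e ∈ treeEdges D.bot 0, c e.1 ≠ c e.2 := by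
  constructor
  · rintro ⟨C⟩
    refine ⟨fun j => if h : j < D.top.numLeaves + 1 then (C ⟨j, h⟩ : Fin 3) else 0, ?_⟩
    have key : ∀ e : ℕ × ℕ, e ∈ treeEdges D.top 0 ∨ e ∈ treeEdges D.bot 0 →
        (if h : e.1 < D.top.numLeaves + 1 then (C ⟨e.1, h⟩ : Fin 3) else 0) ≠
          if h : e.2 < D.top.numLeaves + 1 then (C ⟨e.2, h⟩ : Fin 3) else 0 := by
      intro e he
      have hlt : e.1 < e.2 ∧ e.2 ≤ D.top.numLeaves := by
        rcases he with h | h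
        · simpa using treeEdges_lt h
        · simpa [D.numLeaves_eq] using treeEdges_lt h
      rw [dif_pos (by omega), dif_pos (by omega)]
      refine C.valid ?_
      rw [TreeDiagram.regionGraph, SimpleGraph.fromRel_adj]
      exact ⟨fun h => by simp at h; omega, Or.inl he⟩
    exact ⟨fun e he => key e (Or.inl he), fun e he => key e (Or.inr he)⟩
  · rintro ⟨c, h1, h2⟩
    refine ⟨SimpleGraph.Coloring.mk (fun j => (c j : Fin 3)) fun {i j} hij => ?_⟩
    rw [TreeDiagram.regionGraph, SimpleGraph.fromRel_adj] at hij
    rcases hij.2 with (h | h) | (h | h)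
    · exact h1 _ h
    · exact h2 _ h
    · exact (h1 _ h).symm
    · exact (h2 _ h).symm

theorem TreeDiagram.colorable_three_iff (D : TreeDiagram) :
    D.regionGraph.Colorable 3 ↔ leafSigns D.top = leafSigns D.bot := by
  rw [D.colorable_three_iff_exists]
  simp only [forall_treeEdges_iff, zero_add, ← D.numLeaves_eq]
  constructor
  · rintro ⟨c, ⟨hd, h1⟩, -, h2⟩
    rw [h1] at h2
    exact List.map_injective_iff.2 (mul_right_injective₀ hd) h2
  · intro h
    obtain ⟨c, hc⟩ := exists_colorSteps_eq (leafSigns D.top)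
    rw [leafSigns, List.length_map, length_leafWords, ← leafSigns] at hc
    have hs := congrArg List.sum hc
    rw [sum_leafSigns, sum_colorSteps, zero_add] at hs
    refine ⟨c, ?_⟩
    simp [hs, hc, h]

theorem neg_one_pow_eq_iff (m n : ℕ) :
    (-1 : ZMod 3) ^ m = (-1) ^ n ↔ Even (m - n : ℤ) := by
  have h : (-1 : ZMod 3) ≠ 1 := by decide
  rw [Int.even_sub, Int.even_coe_nat, Int.even_coe_nat]
  rcases m.even_or_odd with hm | hm <;> rcases n.even_or_odd with hn | hn <;>
    simp [hm, hn, hm.neg_one_pow, hn.neg_one_pow, h, h.symm, ← Nat.not_odd_iff_even]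

theorem TreeDiagram.leafSigns_eq_iff (D : TreeDiagram) :
    leafSigns D.top = leafSigns D.bot ↔ ∀ p ∈ (leafWords D.top).zip (leafWords D.bot),
      Even (p.1.length - p.2.length : ℤ) := by
  have hlen : (leafWords D.top).length = (leafWords D.bot).length := by
    rw [length_leafWords, length_leafWords, D.numLeaves_eq]
  rw [leafSigns, leafSigns, ← List.forall₂_eq_eq_eq, List.forall₂_map_left_iff,
    List.forall₂_map_right_iff, List.forall₂_iff_zip]
  simp only [hlen, true_and, neg_one_pow_eq_iff, Prod.forall]

theorem isThreeColorable_iff (f : thompsonF) : IsThreeColorable f ↔ f ∈ evenSlopeSubgroup := by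
  have key : ∀ D : TreeDiagram, D.Represents f →
      (D.regionGraph.Colorable 3 ↔ f ∈ evenSlopeSubgroup) := fun D hD => by
    rw [D.colorable_three_iff, D.leafSigns_eq_iff, mem_evenSlopeSubgroup, hD.hasEvenSlopes_iff]
  constructor
  · rintro ⟨D, hD, hc⟩
    exact (key D hD.1).1 hc
  · intro h
    obtain ⟨D, hD⟩ := IsThompson.exists_isReducedFor f.2
    exact ⟨D, hD, (key D hD.1).2 h⟩

/-! ### The commensurator -/

/-- If some positive power of each element with even slopes is conjugated by `u` to an element with
even slopes, then the parity of the slope of `u` cannot change at a dyadic point `p`: a suitable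
`v` with even slopes moves an interval on the left of `p` to the right of `p`, and there `u v u⁻¹`
has slope `2 ^ (l + j - k)`, where `v` has slope `2 ^ j`. -/
theorem even_sub_of_conj {u : thompsonF}
    (hu : ∀ h ∈ evenSlopeSubgroup, ∃ n, 0 < n ∧ u * h ^ n * u⁻¹ ∈ evenSlopeSubgroup)
    {a p b : unitInterval} {k l : ℤ} (hp : IsDyadic p) (hap : a < p) (hpb : p < b)
    (hk : HasSlopeOn u k a p) (hl : HasSlopeOn u l p b) : Even (l - k) := by
  obtain ⟨h, hC, hh⟩ := exists_mem_evenSlopeSubgroup_lt hp hap hpb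
  obtain ⟨n, hn, hconj⟩ := hu h hC
  obtain ⟨hv1, hv2⟩ := hh n hn
  have hvC : h ^ n ∈ evenSlopeSubgroup := pow_mem hC n
  generalize h ^ n = v at hv1 hv2 hvC hconj
  obtain ⟨u, tu⟩ := u
  obtain ⟨v, tv⟩ := v
  have hcont : ∀ᶠ x in nhdsWithin p (Set.Iio p), p < v x :=
    (v.continuous.continuousAt.eventually (lt_mem_nhds hv1)).filter_mono nhdsWithin_le_nhds
  have hpe : ∀ᶠ x in nhdsWithin p (Set.Iio p), x ∈ Set.Ioo a p :=
    Ioo_mem_nhdsLT hap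
  have : (nhdsWithin p (Set.Iio p)).NeBot := nhdsLT_neBot_of_exists_lt ⟨a, hap⟩
  obtain ⟨a', ha'1, ha'2⟩ := (hcont.and hpe).exists
  obtain ⟨b', j, h1, h2, h3⟩ := tv.exists_hasSlopeOn ha'2.2
  have ej : Even j := hvC _ _ _ h1 h3
  have hvb : v b' ≤ b := (tv.1.monotone h2).trans hv2
  have h4 : HasSlopeOn (u * v) (l + j) a' b' := (hl.mono ha'1.le hvb).mul tv.1 h3
  have h5 : HasSlopeOn u k a' b' := hk.mono ha'2.1.le h2
  have h6 : HasSlopeOn u⁻¹ (-k) (u a') (u b') := h5.inv tu.1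
  have hinv : ∀ x, (u⁻¹ : unitInterval ≃ₜ unitInterval) (u x) = x := u.symm_apply_apply
  have h7 : HasSlopeOn (u * v * u⁻¹) (l + j + -k) (u a') (u b') := by
    refine HasSlopeOn.mul (thompsonF.inv_mem tu).1 ?_ h6
    rwa [hinv, hinv]
  have h8 : Even (l + j + -k) := hconj _ _ _ (tu.1 h1) h7
  have : l - k = l + j + -k - j := by ring
  rw [this]
  exact h8.sub ej

/-- The parity of the slope of `u` is constant along the leaves of a tree diagram by
`even_sub_of_conj`, and it cannot be odd throughout, because the signs of the leaves of any tree add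
up to `1` modulo `3`. -/
theorem mem_evenSlopeSubgroup_of_conj {u : thompsonF}
    (hu : ∀ h ∈ evenSlopeSubgroup, ∃ n, 0 < n ∧ u * h ^ n * u⁻¹ ∈ evenSlopeSubgroup) :
    u ∈ evenSlopeSubgroup := by
  obtain ⟨D, hD⟩ := IsThompson.exists_represents u.2
  have hmap := (D.represents_iff _).1 hD
  have hlen : (leafWords D.top).length = (leafWords D.bot).length := by
    rw [length_leafWords, length_leafWords, D.numLeaves_eq]
  rw [mem_evenSlopeSubgroup, hD.hasEvenSlopes_iff]
  set Z := (leafWords D.top).zip (leafWords D.bot) with hZ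
  let s : List Bool × List Bool → ℤ := fun p => p.1.length - p.2.length
  -- `s p` is the exponent of the slope of `u` on the interval of the leaf `p.1`.
  have hchain : Z.IsChain fun p q => Even (s q - s p) := by
    rw [List.isChain_iff_getElem]
    intro i hi
    have hi' : i + 1 < (leafWords D.top).length := by simp [hZ] at hi; omega
    have htop := List.isChain_iff_getElem.1 (tiles_leafWords D.top).isChain i hi'
    have hk := (hmap _ (List.getElem_mem (show i < Z.length by omega))).hasSlopeOn
    have hl := (hmap _ (List.getElem_mem hi)).hasSlopeOn
    have e1 : (Z[i]'(by omega)).1 = (leafWords D.top)[i] := by simp [hZ]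
    have e2 : (Z[i + 1]).1 = (leafWords D.top)[i + 1] := by simp [hZ]
    have ep : unitPoint (Z[i]'(by omega)).1 1 = unitPoint (Z[i + 1]).1 0 := by rw [e1, e2, htop]
    refine even_sub_of_conj hu (isDyadic_unitPoint_one _) (unitPoint_zero_lt_one _)
      (b := unitPoint (Z[i + 1]).1 1) ?_ hk ?_
    · rw [ep]; exact unitPoint_zero_lt_one _
    · rw [ep]; exact hl
  have : IsTrans (List Bool × List Bool) (fun p q => Even (s q - s p)) :=
    ⟨fun p q r h h' => by simpa using h'.add h⟩
  have : Std.Symm (fun p q => Even (s q - s p)) := ⟨fun p q h => by simpa using h.neg⟩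
  have hpair : ∀ p ∈ Z, ∀ q ∈ Z, Even (s q - s p) := by
    intro p hp q hq
    exact (List.isChain_iff_pairwise.1 hchain).forall_of_forall (fun _ _ => by simp) hp hq
  by_contra hodd
  push Not at hodd
  obtain ⟨p, hp, hodd⟩ := hodd
  -- All slopes of `u` are odd powers of `2`, so matching leaves have opposite signs.
  have hneg : leafSigns D.top = (leafSigns D.bot).map (-·) := by
    rw [leafSigns, leafSigns, List.map_map, ← List.forall₂_eq_eq_eq, List.forall₂_map_left_iff,
      List.forall₂_map_right_iff, List.forall₂_iff_zip]
    refine ⟨hlen, fun {v w} hvw => ?_⟩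
    have h1 := hpair p hp _ hvw
    have h2 : ¬ Even (v.length - w.length : ℤ) := fun h => hodd (by simpa [s] using h.sub h1)
    have h3 : (-1 : ZMod 3) ^ v.length = (-1) ^ (w.length + 1) := by
      rw [neg_one_pow_eq_iff]
      push_cast
      rw [← sub_sub, Int.even_sub_one]
      exact h2
    rw [h3, pow_succ]
    simp
  have hsum := congrArg List.sum hneg
  rw [← List.sum_neg, sum_leafSigns, sum_leafSigns] at hsum
  revert hsum
  decide

open scoped Pointwise in
theorem le_commensurator {G : Type*} [Group G] (H : Subgroup G) :
    H ≤ Subgroup.Commensurable.commensurator H := by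
  intro g hg
  have h : ConjAct.toConjAct g • H = H := by
    ext x
    rw [Subgroup.mem_pointwise_smul_iff_inv_smul_mem, ConjAct.smul_def, ConjAct.ofConjAct_inv,
      ConjAct.ofConjAct_toConjAct, inv_inv, H.mul_mem_cancel_right hg,
      H.mul_mem_cancel_left (inv_mem hg)]
  rw [Subgroup.Commensurable.commensurator_mem_iff, h]

theorem mainTheorem5 :
    ∃ C : Subgroup thompsonF, (C : Set thompsonF) = {f | IsThreeColorable f} ∧
      Subgroup.Commensurable.commensurator C = C := by
  refine ⟨evenSlopeSubgroup, Set.ext fun f => (isThreeColorable_iff f).symm, ?_⟩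
  refine le_antisymm (fun g hg => ?_) (le_commensurator _)
  rw [← inv_mem_iff]
  refine mem_evenSlopeSubgroup_of_conj fun h hh => ?_
  obtain ⟨n, hn, -, hgn⟩ := Subgroup.exists_pow_mem_of_relIndex_ne_zero hg.1 hh
  refine ⟨n, hn, ?_⟩
  have h' := Subgroup.mem_pointwise_smul_iff_inv_smul_mem.1 hgn.1
  exact h'
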